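/- Let $E=(E^0,E^1,s,r)$ be a directed graph with at least one vertex ($E^0$ and $E^1$ are sets of any cardinality and $s,r\colon E^1\to E^0$ are arbitrary maps), and let $R$ be a unital, possibly non-commutative, associative ring. Let $L_R(E)$ be the Leavitt path algebra of $E$ with coefficients in $R$: the associative, not necessarily unital, $R$-algebra generated by symbols $v$ $(v\in E^0)$ and $f,f^*$ $(f\in E^1)$, the elements of $R$ commuting with the generators, subject to the relations (a) $vw=\delta_{v,w}v$ for all $v,w\in E^0$; (b) $s(f)f=f\,r(f)=f$ for all $f\in E^1$; (c) $r(f)f^*=f^*s(f)=f^*$ for all $f\in E^1$; (d) $f^*f'=\delta_{f,f'}\,r(f)$ for all $f,f'\in E^1$; (e) $\sum_{f\in E^1,\ s(f)=v} ff^*=v$ for every $v\in E^0$ with $0<|s^{-1}(v)|<\infty$. A (not necessarily unital) ring $S$ is called prime if $\{0\}$ is a proper ideal of $S$ and, for all two-sided ideals $A,B$ of $S$, $AB=\{0\}$ implies $A=\{0\}$ or $B=\{0\}$. The graph $E$ satisfies condition (MT-3) if for all $u,v\in E^0$ there are a vertex $w\in E^0$ and directed paths (possibly of length zero) from $u$ to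 $w$ and from $v$ to $w$. Then $L_R(E)$ is prime if and only if $R$ is prime and $E$ satisfies condition (MT-3). -/

import Mathlib

/-- A directed graph `E = (E⁰, E¹, s, r)`: loops, parallel edges and infinitely many vertices or
edges are allowed. -/
structure DirectedGraph where
  /-- The set `E⁰` of vertices. -/
  Vertex : Type*
  /-- The set `E¹` of edges. -/
  Edge : Type*
  /-- The source of an edge. -/
  source : Edge → Vertex
  /-- The range of an edge. -/
  range : Edge → Vertex

namespace DirectedGraph

/-- `E.IsPath u p w`: the list of edges `p = f₁ f₂ … fₙ` is a path from `u` to `w`, that is,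
`s(f₁) = u`, `r(fᵢ) = s(fᵢ₊₁)` and `r(fₙ) = w`; the empty list is the path of length zero at a
vertex. -/
def IsPath (E : DirectedGraph) : E.Vertex → List E.Edge → E.Vertex → Prop
  | u, [], w => u = w
  | u, f :: p, w => E.source f = u ∧ E.IsPath (E.range f) p w

/-- The preorder `u ≥ w` on vertices: there is a path (possibly of length zero) from `u` to `w`. -/
def Reaches (E : DirectedGraph) (u w : E.Vertex) : Prop :=
  ∃ p : List E.Edge, E.IsPath u p w

/-- Condition (MT-3): the preorder `≥` is downward directed. -/
def MT3 (E : DirectedGraph) : Prop :=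
  ∀ u v : E.Vertex, ∃ w : E.Vertex, E.Reaches u w ∧ E.Reaches v w

/-- The generators of the Leavitt path algebra: the vertices `v`, the edges `f`, and the ghost
edges `f*`. -/
inductive LeavittGen (E : DirectedGraph)
  | vertex (v : E.Vertex)
  | edge (f : E.Edge)
  | ghost (f : E.Edge)

end DirectedGraph

noncomputable section

/-- The free associative (not necessarily unital) `R`-ring on the generators, in which the
elements of `R` commute with the generators: its elements are the finite sums of terms `a • w`
with `a : R` and `w` a nonempty word in the generators. -/
abbrev LeavittFree (R : Type*) [Ring R] (E : DirectedGraph) : Type _ :=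
  MonoidAlgebra R (FreeSemigroup E.LeavittGen)

namespace LeavittFree

variable (R : Type*) [Ring R] (E : DirectedGraph)

/-- The generator `v`, for a vertex `v`. -/
def vertex (v : E.Vertex) : LeavittFree R E :=
  MonoidAlgebra.single (FreeSemigroup.of (DirectedGraph.LeavittGen.vertex v)) 1

/-- The generator `f`, for an edge `f`. -/
def edge (f : E.Edge) : LeavittFree R E :=
  MonoidAlgebra.single (FreeSemigroup.of (DirectedGraph.LeavittGen.edge f)) 1

/-- The generator `f*`, for an edge `f`. -/
def ghost (f : E.Edge) : LeavittFree R E :=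
  MonoidAlgebra.single (FreeSemigroup.of (DirectedGraph.LeavittGen.ghost f)) 1

end LeavittFree

open LeavittFree in
/-- The defining relations of the Leavitt path algebra. -/
inductive LeavittRelation (R : Type*) [Ring R] (E : DirectedGraph) :
    LeavittFree R E → LeavittFree R E → Prop
  | vertex_mul_self (v : E.Vertex) :
      LeavittRelation R E (vertex R E v * vertex R E v) (vertex R E v)
  | vertex_mul_of_ne (v w : E.Vertex) (h : v ≠ w) :
      LeavittRelation R E (vertex R E v * vertex R E w) 0
  | source_mul_edge (f : E.Edge) :
      LeavittRelation R E (vertex R E (E.source f) * edge R E f) (edge R E f)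
  | edge_mul_range (f : E.Edge) :
      LeavittRelation R E (edge R E f * vertex R E (E.range f)) (edge R E f)
  | range_mul_ghost (f : E.Edge) :
      LeavittRelation R E (vertex R E (E.range f) * ghost R E f) (ghost R E f)
  | ghost_mul_source (f : E.Edge) :
      LeavittRelation R E (ghost R E f * vertex R E (E.source f)) (ghost R E f)
  | ghost_mul_edge_self (f : E.Edge) :
      LeavittRelation R E (ghost R E f * edge R E f) (vertex R E (E.range f))
  | ghost_mul_edge_of_ne (f g : E.Edge) (h : f ≠ g) :
      LeavittRelation R E (ghost R E f * edge R E g) 0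
  | sum_edge_mul_ghost (v : E.Vertex) (hfin : {f : E.Edge | E.source f = v}.Finite)
      (hne : {f : E.Edge | E.source f = v}.Nonempty) :
      LeavittRelation R E (∑ f ∈ hfin.toFinset, edge R E f * ghost R E f) (vertex R E v)

/-- The `R`-linear ring congruence generated by the defining relations. As the free ring has no
identity element, the scalar multiples of the relations are put in explicitly; right multiples
come for free, since the coefficients occurring in the relations are central. -/
def leavittCon (R : Type*) [Ring R] (E : DirectedGraph) : RingCon (LeavittFree R E) :=
  ringConGen fun x y => ∃ (a : R) (x' y' : LeavittFree R E),
    LeavittRelation R E x' y' ∧ x = a • x' ∧ y = a • y'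

/-- The Leavitt path algebra `L_R(E)`, as a ring that need not have an identity element. -/
abbrev LeavittPathAlgebra (R : Type*) [Ring R] (E : DirectedGraph) : Type _ :=
  (leavittCon R E).Quotient

end

/-- A two-sided ideal `P` of a (not necessarily unital) ring is prime if it is proper and, for all
two-sided ideals `A` and `B`, `AB ⊆ P` implies `A ⊆ P` or `B ⊆ P`. Here `AB`, the set of finite
sums of products `ab`, lies in `P` exactly when all the products do. -/
def IsPrimeTwoSidedIdeal {S : Type*} [NonUnitalRing S] (P : TwoSidedIdeal S) : Prop :=
  P ≠ ⊤ ∧ ∀ A B : TwoSidedIdeal S, (∀ a ∈ A, ∀ b ∈ B, a * b ∈ P) → A ≤ P ∨ B ≤ P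

/-- A (not necessarily unital) ring is prime if its zero ideal is a prime ideal. -/
def IsPrimeRing (S : Type*) [NonUnitalRing S] : Prop :=
  IsPrimeTwoSidedIdeal (⊥ : TwoSidedIdeal S)

/-! Forward, the argument is one on leading terms. By graded reduction (`exists_mul_mul_eq_vertex`),
a nonzero homogeneous element can be multiplied on both sides to a nonzero multiple `a v` of a
vertex: edges on the right absorb ghost edges, then ghost edges on the left strip real ones. Applied
to the top component of an arbitrary nonzero element, this gives `a v` plus terms of lower degree.
For nonzero `x ∈ A` and `y ∈ B`, (MT-3) moves both leading terms to a common vertex `u`, since `p*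
(a v) p = a u` for a path `p` from `v` to `u`. The products then give `X = a u + lower` and `Y = b u
+ lower`, and `X (r u) Y = 0` forces `a r b = 0` for every `r`, against primeness of `R`.

This needs `a v ≠ 0` for `a ≠ 0`, and a notion of degree. Both come from a representation on
functions with a degree coordinate. `degreeLE n` consists of the elements raising degree by at most
`n`; a filtration suffices, so the sum of the homogeneous components need not be shown direct.

Conversely, if `I J = 0` in `R`, the ideals that `I` and `J` generate in the algebra multiply to
zero. If `u` and `v` reach no common vertex, every `u (p q*) v` vanishes, as `p` and `q` end at the
same vertex; so `u L v = 0`. -/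

namespace DirectedGraph

/-! ### Boundary labels -/

/-- A labelling of the boundary of the graph: the set `K` splits, for each vertex `v` that emits an
edge, as the disjoint union of the images of injections indexed by the edges emitted by `v`. -/
theorem exists_edge_shift (E : DirectedGraph) :
    ∃ shift : E.Edge → (ℕ ⊕ E.Edge) → (ℕ ⊕ E.Edge),
      (∀ f g k l, E.source f = E.source g → shift f k = shift g l → f = g ∧ k = l) ∧
      ∀ v, {f : E.Edge | E.source f = v}.Nonempty → ∀ k, ∃ f l, E.source f = v ∧ shift f l = k := by
  have key : ∀ v, {f : E.Edge | E.source f = v}.Nonempty →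
      Nonempty ({f : E.Edge // E.source f = v} × (ℕ ⊕ E.Edge) ≃ (ℕ ⊕ E.Edge)) := by
    rintro v ⟨f, hf⟩
    rw [← Cardinal.eq, Cardinal.mk_prod, Cardinal.lift_id, Cardinal.lift_id]
    -- `K = ℕ ⊕ E¹` is infinite and at least as large as any set of edges, so `s⁻¹(v) × K` and `K`
    -- are equipotent once `s⁻¹(v)` is nonempty.
    refine Cardinal.mul_eq_right (Cardinal.aleph0_le_mk _) ?_ ?_
    · exact Cardinal.mk_le_of_injective (f := fun x => Sum.inr x.1)
        fun x y h => Subtype.ext (Sum.inr_injective h)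
    · exact Cardinal.mk_ne_zero_iff.2 ⟨⟨f, hf⟩⟩
  refine ⟨fun f k => (key (E.source f) ⟨f, rfl⟩).some (⟨f, rfl⟩, k), ?_, ?_⟩
  · intro f g k l h
    -- The bijections at `s(f)` and `s(g)` have different types; making the two vertices variables
    -- lets their equality be substituted.
    have aux : ∀ v w (hv : v = w) (h1 : {f : E.Edge | E.source f = v}.Nonempty)
        (h2 : {f : E.Edge | E.source f = w}.Nonempty) (x : {f : E.Edge // E.source f = v})
        (y : {f : E.Edge // E.source f = w}),
        (key v h1).some (x, k) = (key w h2).some (y, l) → x.1 = y.1 ∧ k = l := by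
      rintro v _ rfl h1 h2 x y h
      have := (key v h1).some.injective h
      simp only [Prod.mk.injEq] at this
      exact ⟨congrArg _ this.1, this.2⟩
    exact aux _ _ h ⟨f, rfl⟩ ⟨g, rfl⟩ ⟨f, rfl⟩ ⟨g, rfl⟩
  · intro v hv k
    obtain ⟨⟨⟨f, rfl⟩, l⟩, h⟩ := (key v hv).some.surjective k
    exact ⟨f, l, rfl, h⟩

/-- The injection of `K` into itself attached to an edge. -/
noncomputable def shift (E : DirectedGraph) : E.Edge → (ℕ ⊕ E.Edge) → (ℕ ⊕ E.Edge) :=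
  E.exists_edge_shift.choose

theorem shift_inj (E : DirectedGraph) {f g : E.Edge} {k l : ℕ ⊕ E.Edge}
    (h : E.source f = E.source g) (h' : E.shift f k = E.shift g l) : f = g ∧ k = l :=
  E.exists_edge_shift.choose_spec.1 f g k l h h'

theorem exists_shift_eq (E : DirectedGraph) {v : E.Vertex}
    (hv : {f : E.Edge | E.source f = v}.Nonempty) (k : ℕ ⊕ E.Edge) :
    ∃ f l, E.source f = v ∧ E.shift f l = k :=
  E.exists_edge_shift.choose_spec.2 v hv k

end DirectedGraph

/-! ### The representation on boundary functions -/

noncomputable section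

open DirectedGraph

namespace LeavittFree

variable (R : Type*) [Ring R] (E : DirectedGraph)

/-- The space of functions on which the Leavitt path algebra is represented; the last coordinate
records the degree. -/
abbrev BoundaryFun := E.Vertex → (ℕ ⊕ E.Edge) → ℤ → R

open Classical in
/-- The action of a vertex: restriction of functions. -/
def vertexOp (v : E.Vertex) : AddMonoid.End (BoundaryFun R E) where
  toFun φ w k n := if w = v then φ w k n else 0
  map_zero' := by ext; simp
  map_add' φ ψ := by ext; simp only [Pi.add_apply]; split_ifs <;> simp

open Classical in
/-- The action of an edge. -/
def edgeOp (f : E.Edge) : AddMonoid.End (BoundaryFun R E) where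
  toFun φ w k n := if h : w = E.source f ∧ ∃ l, E.shift f l = k then
    φ (E.range f) h.2.choose (n - 1) else 0
  map_zero' := by ext; simp
  map_add' φ ψ := by ext; simp only [Pi.add_apply]; split_ifs <;> simp

open Classical in
/-- The action of a ghost edge. -/
def ghostOp (f : E.Edge) : AddMonoid.End (BoundaryFun R E) where
  toFun φ w k n := if w = E.range f then φ (E.source f) (E.shift f k) (n + 1) else 0
  map_zero' := by ext; simp
  map_add' φ ψ := by ext; simp only [Pi.add_apply]; split_ifs <;> simp

variable {R E}

theorem end_mul_apply {M : Type*} [AddCommMonoid M] (S T : AddMonoid.End M) (x : M) :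
    (S * T) x = S (T x) := rfl

open Classical in
theorem vertexOp_apply (v : E.Vertex) (φ : BoundaryFun R E) (w k n) :
    vertexOp R E v φ w k n = if w = v then φ w k n else 0 := rfl

open Classical in
theorem ghostOp_apply (f : E.Edge) (φ : BoundaryFun R E) (w k n) :
    ghostOp R E f φ w k n = if w = E.range f then φ (E.source f) (E.shift f k) (n + 1) else 0 := rfl

open Classical in
theorem edgeOp_apply_shift (f : E.Edge) (φ : BoundaryFun R E) (k n) :
    edgeOp R E f φ (E.source f) (E.shift f k) n = φ (E.range f) k (n - 1) := by
  have h : E.source f = E.source f ∧ ∃ l, E.shift f l = E.shift f k := ⟨rfl, k, rfl⟩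
  -- The chosen preimage is `k` itself, because `shift f` is injective.
  have := (E.shift_inj rfl h.2.choose_spec).2
  change dite _ _ _ = _
  rw [dif_pos h, this]

theorem edgeOp_apply_of_not (f : E.Edge) (φ : BoundaryFun R E) (w k n)
    (h : ¬ (w = E.source f ∧ ∃ l, E.shift f l = k)) : edgeOp R E f φ w k n = 0 :=
  dif_neg h

variable (R E)

/-- The action of a generator. -/
def genOp : E.LeavittGen → AddMonoid.End (BoundaryFun R E)
  | .vertex v => vertexOp R E v
  | .edge f => edgeOp R E f
  | .ghost f => ghostOp R E f

/-- Generators only move or erase coordinates, while `a` multiplies every value on the left; hence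
no commutativity of `R` is needed. -/
theorem commute_genOp (a : R) (x : E.LeavittGen) :
    Commute (Module.toAddMonoidEnd R (BoundaryFun R E) a) (genOp R E x) := by
  ext φ w k n
  cases x with
  | vertex v =>
    change a • vertexOp R E v φ w k n = vertexOp R E v (a • φ) w k n
    simp [vertexOp_apply]
  | ghost f =>
    change a • ghostOp R E f φ w k n = ghostOp R E f (a • φ) w k n
    simp [ghostOp_apply]
  | edge f =>
    change a • edgeOp R E f φ w k n = edgeOp R E f (a • φ) w k n
    by_cases h : w = E.source f ∧ ∃ l, E.shift f l = k
    · obtain ⟨rfl, l, rfl⟩ := h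
      simp [edgeOp_apply_shift]
    · simp [edgeOp_apply_of_not _ _ _ _ _ h]

theorem commute_lift_genOp (a : R) (x : FreeSemigroup E.LeavittGen) :
    Commute (Module.toAddMonoidEnd R (BoundaryFun R E) a) (FreeSemigroup.lift (genOp R E) x) := by
  induction x using FreeSemigroup.recOnMul with
  | ih1 x => exact commute_genOp R E a x
  | ih2 x y hx hy => rw [map_mul]; exact hx.mul_right hy

/-- The representation of the free ring on functions on the boundary. -/
def rep : LeavittFree R E →ₙ+* AddMonoid.End (BoundaryFun R E) where
  toFun := MonoidAlgebra.liftNC (Module.toAddMonoidEnd R (BoundaryFun R E) :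
    R →+ AddMonoid.End (BoundaryFun R E)) (FreeSemigroup.lift (genOp R E))
  map_zero' := map_zero _
  map_add' := map_add _
  map_mul' x y := MonoidAlgebra.liftNC_mul _ _ x y fun _ => commute_lift_genOp R E _ _

theorem rep_single (w : FreeSemigroup E.LeavittGen) (a : R) :
    rep R E (MonoidAlgebra.single w a) =
      Module.toAddMonoidEnd R (BoundaryFun R E) a * FreeSemigroup.lift (genOp R E) w :=
  MonoidAlgebra.liftNC_single _ _ _ _

theorem rep_smul (a : R) (x : LeavittFree R E) :
    rep R E (a • x) = Module.toAddMonoidEnd R (BoundaryFun R E) a * rep R E x := by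
  induction x using MonoidAlgebra.induction_linear with
  | zero => simp
  | add x y hx hy => rw [smul_add, map_add, hx, hy, map_add, mul_add]
  | single w b => rw [MonoidAlgebra.smul_single, rep_single, rep_single, smul_eq_mul, map_mul,
      mul_assoc]

theorem rep_vertex (v : E.Vertex) : rep R E (vertex R E v) = vertexOp R E v := by
  rw [vertex, rep_single, map_one, one_mul]; rfl

theorem rep_edge (f : E.Edge) : rep R E (edge R E f) = edgeOp R E f := by
  rw [edge, rep_single, map_one, one_mul]; rfl

theorem rep_ghost (f : E.Edge) : rep R E (ghost R E f) = ghostOp R E f := by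
  rw [ghost, rep_single, map_one, one_mul]; rfl

/-- Relation (d) reflects that edges with a common source have injective shifts with disjoint
images, and relation (e) that these images cover `K`. -/
theorem rep_eq_of_relation {x y : LeavittFree R E} (h : LeavittRelation R E x y) :
    rep R E x = rep R E y := by
  induction h with
  | vertex_mul_self v =>
    rw [map_mul, rep_vertex]
    ext φ w k n
    simp only [end_mul_apply, vertexOp_apply]
    split_ifs <;> rfl
  | vertex_mul_of_ne v w h =>
    rw [map_mul, rep_vertex, rep_vertex, map_zero]
    ext φ u k n
    simp only [end_mul_apply, vertexOp_apply]
    split_ifs with h1 h2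
    · exact absurd (h1.symm.trans h2) h
    · rfl
    · rfl
  | source_mul_edge f =>
    rw [map_mul, rep_vertex, rep_edge]
    ext φ w k n
    simp only [end_mul_apply, vertexOp_apply]
    split_ifs with h
    · rfl
    · exact (edgeOp_apply_of_not _ _ _ _ _ fun h' => h h'.1).symm
  | edge_mul_range f =>
    rw [map_mul, rep_vertex, rep_edge]
    ext φ w k n
    simp only [end_mul_apply]
    by_cases h : w = E.source f ∧ ∃ l, E.shift f l = k
    · obtain ⟨rfl, l, rfl⟩ := h
      simp [edgeOp_apply_shift, vertexOp_apply]
    · simp [edgeOp_apply_of_not _ _ _ _ _ h]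
  | range_mul_ghost f =>
    rw [map_mul, rep_vertex, rep_ghost]
    ext φ w k n
    simp only [end_mul_apply, vertexOp_apply, ghostOp_apply]
    split_ifs <;> rfl
  | ghost_mul_source f =>
    rw [map_mul, rep_vertex, rep_ghost]
    ext φ w k n
    simp only [end_mul_apply, vertexOp_apply, ghostOp_apply, if_true]
  | ghost_mul_edge_self f =>
    rw [map_mul, rep_vertex, rep_ghost, rep_edge]
    ext φ w k n
    simp only [end_mul_apply, vertexOp_apply, ghostOp_apply, edgeOp_apply_shift,
      add_sub_cancel_right]
    split_ifs with h
    · rw [h]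
    · rfl
  | ghost_mul_edge_of_ne f g h =>
    rw [map_mul, rep_ghost, rep_edge, map_zero]
    ext φ w k n
    simp only [end_mul_apply, ghostOp_apply]
    rw [edgeOp_apply_of_not, ite_self]
    · rfl
    · rintro ⟨h1, l, h2⟩
      exact h (E.shift_inj h1 h2.symm).1
  | sum_edge_mul_ghost v hfin hne =>
    simp only [map_sum, map_mul, rep_edge, rep_ghost, rep_vertex]
    ext φ w k n
    have hsum : (∑ f ∈ hfin.toFinset, edgeOp R E f * ghostOp R E f) φ w k n =
        ∑ f ∈ hfin.toFinset, edgeOp R E f (ghostOp R E f φ) w k n := by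
      let ev : AddMonoid.End (BoundaryFun R E) →+ R :=
        { toFun := fun T => T φ w k n
          map_zero' := rfl
          map_add' := fun _ _ => rfl }
      exact map_sum ev _ _
    rw [hsum, vertexOp_apply]
    split_ifs with h
    · subst h
      -- Exactly one edge at this vertex has `k` in its image; its summand is the only one that
      -- survives.
      obtain ⟨f, l, hf, rfl⟩ := E.exists_shift_eq hne k
      rw [Finset.sum_eq_single f]
      · subst hf
        rw [edgeOp_apply_shift, ghostOp_apply, if_pos rfl, sub_add_cancel]
      · intro g hg hgf
        refine edgeOp_apply_of_not _ _ _ _ _ ?_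
        rintro ⟨h1, m, h2⟩
        exact hgf (E.shift_inj (h1.symm.trans hf.symm) h2).1
      · intro hf'
        exact absurd (hfin.mem_toFinset.2 hf) hf'
    · refine Finset.sum_eq_zero fun f hf => edgeOp_apply_of_not _ _ _ _ _ fun h' => h ?_
      exact h'.1.trans (hfin.mem_toFinset.1 hf)

end LeavittFree

/-! ### The quotient and its relations -/

namespace LeavittPathAlgebra

variable (R : Type*) [Ring R] (E : DirectedGraph)

/-- The projection of the free ring onto the Leavitt path algebra. -/
def mk : LeavittFree R E →ₙ+* LeavittPathAlgebra R E where
  toFun x := (x : (leavittCon R E).Quotient)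
  map_zero' := rfl
  map_add' _ _ := rfl
  map_mul' _ _ := rfl

theorem mk_surjective : Function.Surjective (mk R E) := Quotient.mk''_surjective

variable {R E} in
theorem mk_eq_of_relation {x y : LeavittFree R E} (h : LeavittRelation R E x y) (a : R) :
    mk R E (a • x) = mk R E (a • y) :=
  (RingCon.eq _).2 (RingCon.le_ringConGen _ _ ⟨a, x, y, h, rfl, rfl⟩)

/-- The congruence defined by the representation of the free ring. -/
def repCon : RingCon (LeavittFree R E) where
  r x y := LeavittFree.rep R E x = LeavittFree.rep R E y
  iseqv := ⟨fun _ => rfl, Eq.symm, Eq.trans⟩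
  add' h h' := by rw [map_add, map_add, h, h']
  mul' h h' := by rw [map_mul, map_mul, h, h']

theorem leavittCon_le_repCon : leavittCon R E ≤ repCon R E := by
  refine RingCon.ringConGen_le.2 ?_
  rintro _ _ ⟨a, x, y, h, rfl, rfl⟩
  change LeavittFree.rep R E _ = LeavittFree.rep R E _
  rw [LeavittFree.rep_smul, LeavittFree.rep_smul, LeavittFree.rep_eq_of_relation R E h]

/-- The representation of the Leavitt path algebra on functions on the boundary. -/
def rep : LeavittPathAlgebra R E →ₙ+* AddMonoid.End (LeavittFree.BoundaryFun R E) where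
  toFun := Quotient.lift (LeavittFree.rep R E) fun _ _ h => leavittCon_le_repCon R E h
  map_zero' := map_zero (LeavittFree.rep R E)
  map_add' := by rintro ⟨x⟩ ⟨y⟩; exact map_add (LeavittFree.rep R E) x y
  map_mul' := by rintro ⟨x⟩ ⟨y⟩; exact map_mul (LeavittFree.rep R E) x y

variable {R}

/-- The multiple `a • v` of a vertex. -/
def vertex (a : R) (v : E.Vertex) : LeavittPathAlgebra R E :=
  mk R E (MonoidAlgebra.single (FreeSemigroup.of (LeavittGen.vertex v)) a)

variable (R)

/-- An edge, as an element of the Leavitt path algebra. -/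
def edge (f : E.Edge) : LeavittPathAlgebra R E := mk R E (LeavittFree.edge R E f)

/-- A ghost edge, as an element of the Leavitt path algebra. -/
def ghost (f : E.Edge) : LeavittPathAlgebra R E := mk R E (LeavittFree.ghost R E f)

variable {R E}

theorem vertex_zero (v : E.Vertex) : vertex E (0 : R) v = 0 := by
  rw [vertex, MonoidAlgebra.single_zero, map_zero]

theorem vertex_add (a b : R) (v : E.Vertex) : vertex E (a + b) v = vertex E a v + vertex E b v := by
  rw [vertex, MonoidAlgebra.single_add, map_add]; rfl

theorem vertex_neg (a : R) (v : E.Vertex) : vertex E (-a) v = -vertex E a v := by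
  rw [eq_neg_iff_add_eq_zero, ← vertex_add, neg_add_cancel, vertex_zero]

theorem vertex_mul_vertex (a b : R) (v : E.Vertex) :
    vertex E a v * vertex E b v = vertex E (a * b) v := by
  have := mk_eq_of_relation (LeavittRelation.vertex_mul_self (R := R) v) (a * b)
  rw [vertex, vertex, ← map_mul, vertex]
  simpa [LeavittFree.vertex, MonoidAlgebra.single_mul_single] using this

theorem vertex_mul_vertex_of_ne (a b : R) {v w : E.Vertex} (h : v ≠ w) :
    vertex E a v * vertex E b w = 0 := by
  have := mk_eq_of_relation (LeavittRelation.vertex_mul_of_ne (R := R) v w h) (a * b)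
  rw [vertex, vertex, ← map_mul]
  simpa [LeavittFree.vertex, MonoidAlgebra.single_mul_single] using this

theorem vertex_source_mul_edge (a : R) (f : E.Edge) :
    vertex E a (E.source f) * edge R E f =
      mk R E (MonoidAlgebra.single (FreeSemigroup.of (LeavittGen.edge f)) a) := by
  have := mk_eq_of_relation (LeavittRelation.source_mul_edge (R := R) f) a
  rw [vertex, edge, ← map_mul]
  simpa [LeavittFree.vertex, LeavittFree.edge, MonoidAlgebra.single_mul_single] using this

theorem edge_mul_vertex_range (a : R) (f : E.Edge) :
    edge R E f * vertex E a (E.range f) =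
      mk R E (MonoidAlgebra.single (FreeSemigroup.of (LeavittGen.edge f)) a) := by
  have := mk_eq_of_relation (LeavittRelation.edge_mul_range (R := R) f) a
  rw [vertex, edge, ← map_mul]
  simpa [LeavittFree.vertex, LeavittFree.edge, MonoidAlgebra.single_mul_single] using this

theorem vertex_range_mul_ghost (a : R) (f : E.Edge) :
    vertex E a (E.range f) * ghost R E f =
      mk R E (MonoidAlgebra.single (FreeSemigroup.of (LeavittGen.ghost f)) a) := by
  have := mk_eq_of_relation (LeavittRelation.range_mul_ghost (R := R) f) a
  rw [vertex, ghost, ← map_mul]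
  simpa [LeavittFree.vertex, LeavittFree.ghost, MonoidAlgebra.single_mul_single] using this

theorem ghost_mul_vertex_source (a : R) (f : E.Edge) :
    ghost R E f * vertex E a (E.source f) =
      mk R E (MonoidAlgebra.single (FreeSemigroup.of (LeavittGen.ghost f)) a) := by
  have := mk_eq_of_relation (LeavittRelation.ghost_mul_source (R := R) f) a
  rw [vertex, ghost, ← map_mul]
  simpa [LeavittFree.vertex, LeavittFree.ghost, MonoidAlgebra.single_mul_single] using this

theorem source_mul_edge (f : E.Edge) : vertex E (1 : R) (E.source f) * edge R E f = edge R E f :=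
  vertex_source_mul_edge 1 f

theorem edge_mul_range (f : E.Edge) : edge R E f * vertex E (1 : R) (E.range f) = edge R E f :=
  edge_mul_vertex_range 1 f

theorem range_mul_ghost (f : E.Edge) : vertex E (1 : R) (E.range f) * ghost R E f = ghost R E f :=
  vertex_range_mul_ghost 1 f

theorem ghost_mul_source (f : E.Edge) : ghost R E f * vertex E (1 : R) (E.source f) = ghost R E f :=
  ghost_mul_vertex_source 1 f

theorem vertex_mul_edge (a : R) (f : E.Edge) :
    vertex E a (E.source f) * edge R E f = edge R E f * vertex E a (E.range f) := by
  rw [vertex_source_mul_edge, edge_mul_vertex_range]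

theorem ghost_mul_vertex (a : R) (f : E.Edge) :
    ghost R E f * vertex E a (E.source f) = vertex E a (E.range f) * ghost R E f := by
  rw [vertex_range_mul_ghost, ghost_mul_vertex_source]

theorem vertex_mul_edge_of_ne (a : R) {v : E.Vertex} {f : E.Edge} (h : v ≠ E.source f) :
    vertex E a v * edge R E f = 0 := by
  rw [← source_mul_edge, ← mul_assoc, vertex_mul_vertex_of_ne _ _ h, zero_mul]

theorem ghost_mul_vertex_of_ne (a : R) {v : E.Vertex} {f : E.Edge} (h : E.source f ≠ v) :
    ghost R E f * vertex E a v = 0 := by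
  rw [← ghost_mul_source, mul_assoc, vertex_mul_vertex_of_ne _ _ h, mul_zero]

theorem ghost_mul_edge_self (f : E.Edge) :
    ghost R E f * edge R E f = vertex E (1 : R) (E.range f) := by
  have := mk_eq_of_relation (LeavittRelation.ghost_mul_edge_self (R := R) f) 1
  rw [one_smul, one_smul, map_mul] at this
  exact this

theorem ghost_mul_edge_of_ne {f g : E.Edge} (h : f ≠ g) : ghost R E f * edge R E g = 0 := by
  have := mk_eq_of_relation (LeavittRelation.ghost_mul_edge_of_ne (R := R) f g h) 1
  rw [one_smul, one_smul, map_mul, map_zero] at this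
  exact this

theorem sum_edge_mul_ghost (v : E.Vertex) (hfin : {f : E.Edge | E.source f = v}.Finite)
    (hne : {f : E.Edge | E.source f = v}.Nonempty) :
    ∑ f ∈ hfin.toFinset, edge R E f * ghost R E f = vertex E (1 : R) v := by
  have := mk_eq_of_relation (LeavittRelation.sum_edge_mul_ghost (R := R) v hfin hne) 1
  simp only [one_smul, map_sum, map_mul] at this
  exact this

/-! ### The degree filtration -/

variable (R E)

/-- The elements whose action raises the degree by at most `n`. -/
def degreeLE (n : ℤ) : AddSubgroup (LeavittPathAlgebra R E) where
  carrier := {x | ∀ (φ : LeavittFree.BoundaryFun R E) (k : ℤ),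
    (∀ w l j, k < j → φ w l j = 0) → ∀ w l j, k + n < j → rep R E x φ w l j = 0}
  zero_mem' := fun φ k h w l j hj => by rw [map_zero]; rfl
  add_mem' := fun {x y} hx hy φ k h w l j hj => by
    have : rep R E (x + y) φ w l j = rep R E x φ w l j + rep R E y φ w l j := by
      rw [map_add]; rfl
    rw [this, hx φ k h w l j hj, hy φ k h w l j hj, add_zero]
  neg_mem' := fun {x} hx φ k h w l j hj => by
    have : rep R E (-x) φ w l j = - rep R E x φ w l j := by
      rw [map_neg]; rfl
    rw [this, hx φ k h w l j hj, neg_zero]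

variable {R E}

theorem mul_mem_degreeLE {x y : LeavittPathAlgebra R E} {m n : ℤ} (hx : x ∈ degreeLE R E m)
    (hy : y ∈ degreeLE R E n) : x * y ∈ degreeLE R E (m + n) := by
  intro φ k h w l j hj
  rw [map_mul]
  exact hx _ (k + n) (hy φ k h) w l j (by lia)

theorem degreeLE_mono {m n : ℤ} (h : m ≤ n) : degreeLE R E m ≤ degreeLE R E n :=
  fun _ hx φ k hφ w l j hj => hx φ k hφ w l j (by lia)

theorem rep_vertex (a : R) (v : E.Vertex) :
    rep R E (vertex E a v) = Module.toAddMonoidEnd R _ a * LeavittFree.vertexOp R E v :=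
  LeavittFree.rep_single R E _ a

theorem rep_edge (f : E.Edge) : rep R E (edge R E f) = LeavittFree.edgeOp R E f :=
  LeavittFree.rep_edge R E f

theorem rep_ghost (f : E.Edge) : rep R E (ghost R E f) = LeavittFree.ghostOp R E f :=
  LeavittFree.rep_ghost R E f

theorem rep_vertex_apply (a : R) (v : E.Vertex) (φ : LeavittFree.BoundaryFun R E) (w l j) :
    rep R E (vertex E a v) φ w l j = a * LeavittFree.vertexOp R E v φ w l j := by
  rw [rep_vertex]; rfl

theorem vertex_mem_degreeLE (a : R) (v : E.Vertex) : vertex E a v ∈ degreeLE R E 0 := by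
  intro φ k h w l j hj
  rw [rep_vertex_apply, LeavittFree.vertexOp_apply, h w l j (by lia), ite_self, mul_zero]

theorem edge_mem_degreeLE (f : E.Edge) : edge R E f ∈ degreeLE R E 1 := by
  intro φ k h w l j hj
  rw [rep_edge]
  by_cases h' : w = E.source f ∧ ∃ m, E.shift f m = l
  · obtain ⟨rfl, m, rfl⟩ := h'
    rw [LeavittFree.edgeOp_apply_shift, h _ _ _ (by lia)]
  · exact LeavittFree.edgeOp_apply_of_not _ _ _ _ _ h'

theorem ghost_mem_degreeLE (f : E.Edge) : ghost R E f ∈ degreeLE R E (-1) := by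
  intro φ k h w l j hj
  rw [rep_ghost, LeavittFree.ghostOp_apply, h _ _ _ (by lia), ite_self]

/-- The test function is `1` in degrees at most `0` and vanishes above. Its image under `a v` has
value `a` at `v` in degree `0`, where an operator lowering degree must give `0`. -/
theorem eq_zero_of_vertex_mem_degreeLE {a : R} {v : E.Vertex}
    (h : vertex E a v ∈ degreeLE R E (-1)) : a = 0 := by
  have := h (fun _ _ j => if j ≤ 0 then 1 else 0) 0 (fun w l j hj => if_neg (by lia)) v (Sum.inl 0)
    0 (by lia)
  simpa [rep_vertex_apply, LeavittFree.vertexOp_apply] using this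

theorem eq_zero_of_vertex_eq_zero {a : R} {v : E.Vertex} (h : vertex E a v = 0) : a = 0 :=
  eq_zero_of_vertex_mem_degreeLE (v := v) (h ▸ zero_mem _)

end LeavittPathAlgebra

end

/-! ### Finite decompositions along families of endomorphisms -/

/-- The elements of an additive group that are the sum of their images under a family of additive
endomorphisms, almost all of these images being zero. -/
def finsumSubgroup {ι M : Type*} [AddCommGroup M] (T : ι → M →+ M) : AddSubgroup M where
  carrier := {x | (Function.support fun i => T i x).Finite ∧ ∑ᶠ i, T i x = x}
  zero_mem' := by simp
  add_mem' := by
    rintro x y ⟨hx, hx'⟩ ⟨hy, hy'⟩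
    refine ⟨(hx.union hy).subset ?_, ?_⟩
    · simp only [map_add]
      exact Function.support_add _ _
    · simp only [map_add]
      rw [finsum_add_distrib hx hy, hx', hy']
  neg_mem' := by
    rintro x ⟨hx, hx'⟩
    refine ⟨by simpa using hx, ?_⟩
    simp only [map_neg]
    rw [finsum_neg_distrib, hx']

theorem mem_finsumSubgroup_of_single {ι M : Type*} [AddCommGroup M] {T : ι → M →+ M} {x : M}
    (i : ι) (hi : T i x = x) (h : ∀ j, j ≠ i → T j x = 0) : x ∈ finsumSubgroup T := by
  refine ⟨(Set.finite_singleton i).subset fun j hj => ?_, ?_⟩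
  · by_contra hji
    exact hj (h j hji)
  · rw [finsum_eq_single _ i h, hi]

theorem eq_zero_of_mem_finsumSubgroup {ι M : Type*} [AddCommGroup M] {T : ι → M →+ M} {x : M}
    (hx : x ∈ finsumSubgroup T) (h : ∀ i, T i x = 0) : x = 0 := by
  rw [← hx.2]
  simp [h]

/-! ### Monomials -/

noncomputable section

open DirectedGraph

namespace LeavittPathAlgebra

variable {R : Type*} [Ring R] {E : DirectedGraph}

/-- `IsMonomial k j x`: the element `x` is zero or of the form `a • p q*` for paths `p` and `q` of
lengths `k` and `j`. -/
inductive IsMonomial : ℕ → ℕ → LeavittPathAlgebra R E → Prop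
  | vertex (a : R) (v : E.Vertex) : IsMonomial 0 0 (vertex E a v)
  | edge_mul {k : ℕ} (f : E.Edge) {x : LeavittPathAlgebra R E} (hx : IsMonomial k 0 x) :
      IsMonomial (k + 1) 0 (edge R E f * x)
  | mul_ghost {k j : ℕ} (f : E.Edge) {x : LeavittPathAlgebra R E} (hx : IsMonomial k j x) :
      IsMonomial k (j + 1) (x * ghost R E f)

namespace IsMonomial

variable {k j : ℕ} {x : LeavittPathAlgebra R E}

theorem mul_vertex (hx : IsMonomial k j x) (v : E.Vertex) :
    x * LeavittPathAlgebra.vertex E (1 : R) v = x ∨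
      x * LeavittPathAlgebra.vertex E (1 : R) v = 0 := by
  induction hx with
  | vertex a w =>
    by_cases h : w = v
    · subst h; left; rw [vertex_mul_vertex, mul_one]
    · right; exact vertex_mul_vertex_of_ne _ _ h
  | edge_mul f hx ih =>
    rw [mul_assoc]
    rcases ih with ih | ih <;> rw [ih]
    · exact .inl rfl
    · exact .inr (mul_zero _)
  | mul_ghost f hx ih =>
    by_cases h : E.source f = v
    · subst h; left; rw [mul_assoc, ghost_mul_source]
    · right; rw [mul_assoc, ghost_mul_vertex_of_ne _ h, mul_zero]

theorem vertex_mul (hx : IsMonomial k j x) (v : E.Vertex) :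
    LeavittPathAlgebra.vertex E (1 : R) v * x = x ∨
      LeavittPathAlgebra.vertex E (1 : R) v * x = 0 := by
  induction hx with
  | vertex a w =>
    by_cases h : v = w
    · subst h; left; rw [vertex_mul_vertex, one_mul]
    · right; exact vertex_mul_vertex_of_ne _ _ h
  | edge_mul f hx ih =>
    by_cases h : v = E.source f
    · subst h; left; rw [← mul_assoc, source_mul_edge]
    · right; rw [← mul_assoc, vertex_mul_edge_of_ne _ h, zero_mul]
  | mul_ghost f hx ih =>
    rw [← mul_assoc]
    rcases ih with ih | ih <;> rw [ih]
    · exact .inl rfl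
    · exact .inr (zero_mul _)

theorem exists_mul_vertex_eq (hx : IsMonomial k j x) :
    ∃ v, x * LeavittPathAlgebra.vertex E (1 : R) v = x := by
  induction hx with
  | vertex a v => exact ⟨v, by rw [vertex_mul_vertex, mul_one]⟩
  | edge_mul f hx ih =>
    obtain ⟨v, hv⟩ := ih
    exact ⟨v, by rw [mul_assoc, hv]⟩
  | mul_ghost f hx ih => exact ⟨E.source f, by rw [mul_assoc, ghost_mul_source]⟩

theorem left_edge_mul (hx : IsMonomial k j x) (f : E.Edge) :
    IsMonomial (k + 1) j (edge R E f * x) := by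
  induction hx with
  | vertex a v => exact edge_mul f (vertex a v)
  | edge_mul g hx ih => exact edge_mul f (edge_mul g hx)
  | mul_ghost g hx ih => rw [← mul_assoc]; exact mul_ghost g ih

/-- Without ghost edges, a monomial of positive length can only be `g y`, so the outermost
constructor shows its first edge and `f* g` is either `0` or a vertex. -/
theorem ghost_mul_of_succ (hx : IsMonomial (k + 1) 0 x) (f : E.Edge) :
    ghost R E f * x = 0 ∨ IsMonomial k 0 (ghost R E f * x) := by
  cases hx with
  | edge_mul g hy =>
    by_cases h : f = g
    · subst h
      rw [← mul_assoc, ghost_mul_edge_self]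
      rcases hy.vertex_mul (E.range f) with h | h <;> rw [h]
      · exact .inr hy
      · exact .inl rfl
    · left; rw [← mul_assoc, ghost_mul_edge_of_ne h, zero_mul]

theorem left_ghost_mul (hx : IsMonomial k j x) (f : E.Edge) :
    ghost R E f * x = 0 ∨ ∃ k' j', IsMonomial k' j' (ghost R E f * x) := by
  induction hx with
  | vertex a v =>
    by_cases h : E.source f = v
    · subst h
      rw [ghost_mul_vertex]
      exact .inr ⟨_, _, mul_ghost f (vertex a _)⟩
    · exact .inl (ghost_mul_vertex_of_ne _ h)
  | edge_mul g hx ih =>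
    exact ((edge_mul g hx).ghost_mul_of_succ f).imp id fun h => ⟨_, _, h⟩
  | mul_ghost g hx ih =>
    rw [← mul_assoc]
    rcases ih with ih | ⟨k', j', ih⟩
    · left; rw [ih, zero_mul]
    · exact .inr ⟨_, _, mul_ghost g ih⟩

theorem mul_edge_of_zero (hx : IsMonomial k 0 x) (f : E.Edge) :
    x * edge R E f = 0 ∨ IsMonomial (k + 1) 0 (x * edge R E f) := by
  induction k generalizing x with
  | zero =>
    cases hx with
    | vertex a v =>
      by_cases h : v = E.source f
      · subst h
        rw [vertex_mul_edge]
        exact .inr (edge_mul f (vertex a _))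
      · exact .inl (vertex_mul_edge_of_ne _ h)
  | succ k ih =>
    cases hx with
    | edge_mul g hy =>
      rw [mul_assoc]
      rcases ih hy with h | h
      · left; rw [h, mul_zero]
      · exact .inr (edge_mul g h)

theorem mul_edge_of_succ (hx : IsMonomial k (j + 1) x) (f : E.Edge) :
    x * edge R E f = 0 ∨ IsMonomial k j (x * edge R E f) := by
  cases hx with
  | mul_ghost g hy =>
    by_cases h : g = f
    · subst h
      rw [mul_assoc, ghost_mul_edge_self]
      rcases hy.mul_vertex (E.range g) with h | h <;> rw [h]
      · exact .inr hy
      · exact .inl rfl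
    · left; rw [mul_assoc, ghost_mul_edge_of_ne h, mul_zero]

theorem mem_degreeLE (hx : IsMonomial k j x) : x ∈ degreeLE R E (k - j) := by
  induction hx with
  | vertex a v => simpa using vertex_mem_degreeLE a v
  | @edge_mul k f x hx ih =>
    have := mul_mem_degreeLE (edge_mem_degreeLE f) ih
    convert this using 2
    push_cast; ring
  | @mul_ghost k j f x hx ih =>
    have := mul_mem_degreeLE ih (ghost_mem_degreeLE f)
    convert this using 2
    push_cast; ring

/-- A monomial `a • p q*` can be sandwiched only between vertices that reach the range of `p`. -/
theorem exists_reaches (hx : IsMonomial k j x) : ∃ w, ∀ v,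
    (¬ E.Reaches v w → LeavittPathAlgebra.vertex E (1 : R) v * x = 0) ∧
      (¬ E.Reaches v w → x * LeavittPathAlgebra.vertex E (1 : R) v = 0) := by
  induction hx with
  | vertex a w =>
    refine ⟨w, fun v => ⟨fun h => ?_, fun h => ?_⟩⟩
    · exact vertex_mul_vertex_of_ne _ _ fun h' => h ⟨[], h'⟩
    · exact vertex_mul_vertex_of_ne _ _ fun h' => h ⟨[], h'.symm⟩
  | edge_mul f hx ih =>
    obtain ⟨w, ih⟩ := ih
    refine ⟨w, fun v => ⟨fun h => ?_, fun h => ?_⟩⟩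
    · by_cases hv : v = E.source f
      · subst hv
        rw [← mul_assoc, source_mul_edge, ← edge_mul_range, mul_assoc, (ih (E.range f)).1,
          mul_zero]
        rintro ⟨p, hp⟩
        exact h ⟨f :: p, rfl, hp⟩
      · rw [← mul_assoc, vertex_mul_edge_of_ne _ hv, zero_mul]
    · rw [mul_assoc, (ih v).2 h, mul_zero]
  | mul_ghost f hx ih =>
    obtain ⟨w, ih⟩ := ih
    refine ⟨w, fun v => ⟨fun h => ?_, fun h => ?_⟩⟩
    · rw [← mul_assoc, (ih v).1 h, zero_mul]
    · by_cases hv : E.source f = v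
      · subst hv
        rw [mul_assoc, ghost_mul_source, ← range_mul_ghost, ← mul_assoc, (ih (E.range f)).2,
          zero_mul]
        rintro ⟨p, hp⟩
        exact h ⟨f :: p, rfl, hp⟩
      · rw [mul_assoc, ghost_mul_vertex_of_ne _ hv, mul_zero]

end IsMonomial

/-- The Leavitt path algebra is additively generated by the monomials. -/
theorem closure_isMonomial :
    AddSubgroup.closure {x : LeavittPathAlgebra R E | ∃ k j, IsMonomial k j x} = ⊤ := by
  set C := AddSubgroup.closure {x : LeavittPathAlgebra R E | ∃ k j, IsMonomial k j x}
  -- A word is built by left multiplication by single letters, the coefficient staying with the last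
  -- letter; each letter sends a monomial to a monomial or to zero.
  have hgen : ∀ (g : E.LeavittGen), ∀ x ∈ C,
      mk R E (MonoidAlgebra.single (FreeSemigroup.of g) 1) * x ∈ C := by
    intro g x hx
    refine AddSubgroup.closure_le (C.comap (AddMonoidHom.mulLeft _)) |>.2 ?_ hx
    rintro x ⟨k, j, h⟩
    change _ * x ∈ C
    cases g with
    | vertex v =>
      rcases h.vertex_mul v with h' | h'
      · exact (congrArg (· ∈ C) h').mpr (AddSubgroup.subset_closure ⟨k, j, h⟩)
      · exact (congrArg (· ∈ C) h').mpr (zero_mem _)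
    | edge f => exact AddSubgroup.subset_closure ⟨_, _, h.left_edge_mul f⟩
    | ghost f =>
      rcases h.left_ghost_mul f with h' | ⟨k', j', h'⟩
      · exact (congrArg (· ∈ C) h').mpr (zero_mem _)
      · exact AddSubgroup.subset_closure ⟨_, _, h'⟩
  refine eq_top_iff.2 fun x _ => ?_
  obtain ⟨x, rfl⟩ := mk_surjective R E x
  induction x using MonoidAlgebra.induction_linear with
  | zero => rw [map_zero]; exact zero_mem _
  | add x y hx hy => rw [map_add]; exact add_mem (hx trivial) (hy trivial)
  | single w a =>
    induction w using FreeSemigroup.recOnMul with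
    | ih1 g =>
      refine AddSubgroup.subset_closure ?_
      cases g with
      | vertex v => exact ⟨0, 0, .vertex a v⟩
      | edge f =>
        rw [← edge_mul_vertex_range]
        exact ⟨_, _, .edge_mul f (.vertex a _)⟩
      | ghost f =>
        rw [← vertex_range_mul_ghost]
        exact ⟨_, _, .mul_ghost f (.vertex a _)⟩
    | ih2 g w _ ih =>
      have : MonoidAlgebra.single (FreeSemigroup.of g * w) a =
          MonoidAlgebra.single (FreeSemigroup.of g) 1 * MonoidAlgebra.single w a := by
        rw [MonoidAlgebra.single_mul_single, one_mul]
      rw [this, map_mul]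
      exact hgen g _ (ih trivial)

/-- Every element is the sum of its products with the vertices. -/
theorem mem_finsumSubgroup_vertex (x : LeavittPathAlgebra R E) :
    x ∈ finsumSubgroup fun v : E.Vertex => AddMonoidHom.mulRight (vertex E (1 : R) v) := by
  have hx : x ∈ AddSubgroup.closure {x : LeavittPathAlgebra R E | ∃ k j, IsMonomial k j x} := by
    rw [closure_isMonomial]; trivial
  refine AddSubgroup.closure_le _ |>.2 ?_ hx
  rintro x ⟨k, j, h⟩
  obtain ⟨v, hv⟩ := h.exists_mul_vertex_eq
  refine mem_finsumSubgroup_of_single v hv fun w hw => ?_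
  change x * _ = 0
  rw [← hv, mul_assoc, vertex_mul_vertex_of_ne _ _ hw.symm, mul_zero]

/-- The algebra may have no identity; the finite sum `x = ∑ x v` takes its place. -/
theorem exists_mul_vertex_ne_zero {x : LeavittPathAlgebra R E} (hx : x ≠ 0) :
    ∃ v, x * vertex E (1 : R) v ≠ 0 := by
  by_contra! h
  exact hx (eq_zero_of_mem_finsumSubgroup (mem_finsumSubgroup_vertex x) h)

/-! ### Graded reduction -/

variable (R E)

/-- The additive span of the real paths of length `k`. -/
def realSpan (k : ℕ) : AddSubgroup (LeavittPathAlgebra R E) :=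
  AddSubgroup.closure {x | IsMonomial k 0 x}

/-- The additive span of the monomials of degree `n` with at most `N` ghost edges. -/
def monomialSpan (n : ℤ) (N : ℕ) : AddSubgroup (LeavittPathAlgebra R E) :=
  AddSubgroup.closure {x | ∃ k j : ℕ, IsMonomial k j x ∧ j ≤ N ∧ (k : ℤ) - j = n}

/-- The homogeneous component of degree `n`. -/
def component (n : ℤ) : AddSubgroup (LeavittPathAlgebra R E) :=
  AddSubgroup.closure {x | ∃ k j : ℕ, IsMonomial k j x ∧ (k : ℤ) - j = n}

variable {R E}

theorem ghost_mul_mem_realSpan {k : ℕ} {z : LeavittPathAlgebra R E} (hz : z ∈ realSpan R E (k + 1))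
    (f : E.Edge) : ghost R E f * z ∈ realSpan R E k := by
  refine AddSubgroup.closure_le ((realSpan R E k).comap (AddMonoidHom.mulLeft (ghost R E f)))
    |>.2 ?_ hz
  intro x hx
  change ghost R E f * x ∈ realSpan R E k
  rcases IsMonomial.ghost_mul_of_succ hx f with h | h
  · rw [h]; exact zero_mem _
  · exact AddSubgroup.subset_closure h

/-- `f f*` fixes a path starting with `f`, and `g g*` kills it for `g ≠ f`. No finiteness of the
graph is needed, since an element involves finitely many paths. -/
theorem mem_finsumSubgroup_of_mem_realSpan {k : ℕ} {z : LeavittPathAlgebra R E}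
    (hz : z ∈ realSpan R E (k + 1)) :
    z ∈ finsumSubgroup fun f : E.Edge => AddMonoidHom.mulLeft (edge R E f * ghost R E f) := by
  refine AddSubgroup.closure_le _ |>.2 ?_ hz
  intro x hx
  cases hx with
  | @edge_mul _ f y hy =>
    refine mem_finsumSubgroup_of_single f ?_ fun g hg => ?_
    · change edge R E f * ghost R E f * (edge R E f * y) = _
      rw [mul_assoc, ← mul_assoc (ghost R E f), ghost_mul_edge_self, ← mul_assoc, edge_mul_range]
    · change edge R E g * ghost R E g * (edge R E f * y) = _
      rw [mul_assoc, ← mul_assoc (ghost R E g), ghost_mul_edge_of_ne hg, zero_mul, mul_zero]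

theorem exists_mul_vertex_eq_of_mem_realSpan_zero {z : LeavittPathAlgebra R E}
    (hz : z ∈ realSpan R E 0) (v : E.Vertex) :
    ∃ a, z * vertex E (1 : R) v = vertex E a v := by
  induction hz using AddSubgroup.closure_induction with
  | mem x hx =>
    cases hx with
    | vertex a w =>
      by_cases h : w = v
      · subst h; exact ⟨a * 1, vertex_mul_vertex _ _ _⟩
      · exact ⟨0, by rw [vertex_mul_vertex_of_ne _ _ h, vertex_zero]⟩
  | zero => exact ⟨0, by rw [zero_mul, vertex_zero]⟩
  | add x y _ _ hx hy =>
    obtain ⟨a, ha⟩ := hx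
    obtain ⟨b, hb⟩ := hy
    exact ⟨a + b, by rw [add_mul, ha, hb, vertex_add]⟩
  | neg x _ hx =>
    obtain ⟨a, ha⟩ := hx
    exact ⟨-a, (neg_mul x _).trans (by rw [ha, vertex_neg])⟩

/-- Right multiplication by an edge is injective on real elements ending at its source. -/
theorem mul_source_eq_zero_of_mul_edge_eq_zero {k : ℕ} {z : LeavittPathAlgebra R E}
    (hz : z ∈ realSpan R E k) {f : E.Edge} (h : z * edge R E f = 0) :
    z * vertex E (1 : R) (E.source f) = 0 := by
  induction k generalizing z with
  | zero =>
    obtain ⟨a, ha⟩ := exists_mul_vertex_eq_of_mem_realSpan_zero hz (E.source f)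
    have : vertex E a (E.range f) = 0 := by
      calc vertex E a (E.range f) = ghost R E f * (vertex E a (E.source f) * edge R E f) := by
            rw [vertex_mul_edge, ← mul_assoc, ghost_mul_edge_self, vertex_mul_vertex, one_mul]
        _ = 0 := by rw [← ha, mul_assoc, source_mul_edge, h, mul_zero]
    rw [ha, eq_zero_of_vertex_eq_zero this, vertex_zero]
  | succ k ih =>
    -- Left multiplication by `g*` shortens the paths and keeps the hypothesis `z f = 0`; the
    -- element is then recovered from its products with all `g g*`.
    have key : ∀ g : E.Edge, ghost R E g * z * vertex E (1 : R) (E.source f) = 0 := fun g =>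
      ih (ghost_mul_mem_realSpan hz g) (by rw [mul_assoc, h, mul_zero])
    have hz' : z * vertex E (1 : R) (E.source f) ∈ realSpan R E (k + 1) := by
      refine AddSubgroup.closure_le ((realSpan R E (k + 1)).comap (AddMonoidHom.mulRight _))
        |>.2 ?_ hz
      intro x hx
      change x * vertex E (1 : R) (E.source f) ∈ realSpan R E (k + 1)
      rcases IsMonomial.mul_vertex hx (E.source f) with h | h <;> rw [h]
      · exact AddSubgroup.subset_closure hx
      · exact zero_mem _
    refine eq_zero_of_mem_finsumSubgroup (mem_finsumSubgroup_of_mem_realSpan hz') fun g => ?_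
    change edge R E g * ghost R E g * (z * _) = 0
    rw [mul_assoc, ← mul_assoc (ghost R E g), key, mul_zero]

/-- As `z = ∑ f f* z`, some `f* z` is nonzero, and it is a combination of shorter paths; the descent
ends at multiples of vertices. -/
theorem exists_left_mul_eq_vertex {k : ℕ} {z : LeavittPathAlgebra R E} (hz : z ∈ realSpan R E k)
    (h0 : z ≠ 0) : ∃ y ∈ degreeLE R E (-k), ∃ (a : R) (v : E.Vertex), a ≠ 0 ∧
      y * z * vertex E (1 : R) v = vertex E a v := by
  induction k generalizing z with
  | zero =>
    obtain ⟨v, hv⟩ := exists_mul_vertex_ne_zero h0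
    obtain ⟨a, ha⟩ := exists_mul_vertex_eq_of_mem_realSpan_zero hz v
    refine ⟨vertex E 1 v, by simpa using vertex_mem_degreeLE 1 v, a, v, ?_, ?_⟩
    · rintro rfl
      exact hv (ha.trans (vertex_zero v))
    · rw [mul_assoc, ha, vertex_mul_vertex, one_mul]
  | succ k ih =>
    have : ∃ f, ghost R E f * z ≠ 0 := by
      by_contra! h
      refine h0 (eq_zero_of_mem_finsumSubgroup (mem_finsumSubgroup_of_mem_realSpan hz) fun f => ?_)
      change edge R E f * ghost R E f * z = 0
      rw [mul_assoc, h, mul_zero]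
    obtain ⟨f, hf⟩ := this
    obtain ⟨y, hy, a, v, ha, h⟩ := ih (ghost_mul_mem_realSpan hz f) hf
    refine ⟨y * ghost R E f, ?_, a, v, ha, by rw [mul_assoc y, h]⟩
    convert mul_mem_degreeLE hy (ghost_mem_degreeLE f) using 2
    push_cast; ring

theorem mul_edge_mem_monomialSpan {n : ℤ} {N : ℕ} {x : LeavittPathAlgebra R E}
    (hx : x ∈ monomialSpan R E n (N + 1)) (f : E.Edge) :
    x * edge R E f ∈ monomialSpan R E (n + 1) N := by
  refine AddSubgroup.closure_le ((monomialSpan R E (n + 1) N).comap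
    (AddMonoidHom.mulRight (edge R E f))) |>.2 ?_ hx
  rintro x ⟨k, j, h, hj, hn⟩
  change x * edge R E f ∈ monomialSpan R E (n + 1) N
  cases j with
  | zero =>
    rcases h.mul_edge_of_zero f with h' | h'
    · rw [h']; exact zero_mem _
    · exact AddSubgroup.subset_closure ⟨_, _, h', by lia, by push_cast at *; lia⟩
  | succ j =>
    rcases h.mul_edge_of_succ f with h' | h'
    · rw [h']; exact zero_mem _
    · exact AddSubgroup.subset_closure ⟨_, _, h', by lia, by push_cast at *; lia⟩

theorem mul_vertex_mem_monomialSpan {n : ℤ} {N : ℕ} {x : LeavittPathAlgebra R E}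
    (hx : x ∈ monomialSpan R E n N) (v : E.Vertex) :
    x * vertex E (1 : R) v ∈ monomialSpan R E n N := by
  refine AddSubgroup.closure_le ((monomialSpan R E n N).comap
    (AddMonoidHom.mulRight (vertex E (1 : R) v))) |>.2 ?_ hx
  rintro x ⟨k, j, h, hj, hn⟩
  change x * vertex E (1 : R) v ∈ monomialSpan R E n N
  rcases h.mul_vertex v with h' | h' <;> rw [h']
  · exact AddSubgroup.subset_closure ⟨k, j, h, hj, hn⟩
  · exact zero_mem _

/-- An element splits as a real part and a part recovered from its products with the edges. -/
theorem monomialSpan_le_sup (n : ℤ) (N : ℕ) : monomialSpan R E n N ≤ monomialSpan R E n 0 ⊔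
    finsumSubgroup fun f : E.Edge => AddMonoidHom.mulRight (edge R E f * ghost R E f) := by
  refine AddSubgroup.closure_le _ |>.2 ?_
  rintro x ⟨k, j, h, hj, hn⟩
  cases h with
  | vertex a v =>
    exact (le_sup_left : monomialSpan R E n 0 ≤ _)
      (AddSubgroup.subset_closure ⟨_, _, .vertex a v, le_rfl, hn⟩)
  | edge_mul f hy =>
    exact (le_sup_left : monomialSpan R E n 0 ≤ _)
      (AddSubgroup.subset_closure ⟨_, _, .edge_mul f hy, le_rfl, hn⟩)
  | @mul_ghost _ _ f y hy =>
    refine (le_sup_right : _ ≤ monomialSpan R E n 0 ⊔ _)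
      (mem_finsumSubgroup_of_single f ?_ fun g hg => ?_)
    · change y * ghost R E f * (edge R E f * ghost R E f) = _
      rw [mul_assoc, ← mul_assoc (ghost R E f), ghost_mul_edge_self, range_mul_ghost]
    · change y * ghost R E f * (edge R E g * ghost R E g) = _
      rw [mul_assoc, ← mul_assoc (ghost R E f), ghost_mul_edge_of_ne hg.symm, zero_mul, mul_zero]

theorem exists_mem_realSpan {n : ℤ} {z : LeavittPathAlgebra R E} (hz : z ∈ monomialSpan R E n 0)
    (h0 : z ≠ 0) : ∃ k : ℕ, (k : ℤ) = n ∧ z ∈ realSpan R E k := by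
  obtain ⟨k, rfl⟩ | hn : (∃ k : ℕ, (k : ℤ) = n) ∨ ¬ ∃ k : ℕ, (k : ℤ) = n := em _
  · refine ⟨k, rfl, AddSubgroup.closure_mono ?_ hz⟩
    rintro x ⟨k', j, h, hj, hk⟩
    obtain rfl : j = 0 := by lia
    obtain rfl : k' = k := by simpa using hk
    exact h
  · refine absurd ?_ h0
    refine AddSubgroup.closure_le (⊥ : AddSubgroup (LeavittPathAlgebra R E)) |>.2 ?_ hz
    rintro x ⟨k, j, h, hj, hk⟩
    exact absurd ⟨k, by lia⟩ hn

/-- If `x` is annihilated by all edges on the right, then each nonzero `x v` is real. -/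
theorem exists_mul_vertex_mem_of_mul_edge_eq_zero {n : ℤ} {N : ℕ} {x : LeavittPathAlgebra R E}
    (hx : x ∈ monomialSpan R E n N) (h : ∀ f, x * edge R E f = 0) (v : E.Vertex)
    (hv : x * vertex E (1 : R) v ≠ 0) :
    x * vertex E (1 : R) v ∈ monomialSpan R E n 0 := by
  obtain ⟨z, hz, d, hd, rfl⟩ := AddSubgroup.mem_sup.1 (monomialSpan_le_sup n N hx)
  -- `d = ∑ d f f*`, and `f* v` vanishes unless `f` starts at `v`.
  have hdv : (∀ f, E.source f = v → d * edge R E f = 0) → d * vertex E (1 : R) v = 0 := by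
    intro hf
    have := map_finsum (AddMonoidHom.mulRight (vertex E (1 : R) v)) hd.1
    rw [hd.2] at this
    refine this.trans (finsum_eq_zero_of_forall_eq_zero fun f => ?_)
    change d * (edge R E f * ghost R E f) * vertex E (1 : R) v = 0
    by_cases hfv : E.source f = v
    · rw [← mul_assoc, hf f hfv, zero_mul, zero_mul]
    · rw [mul_assoc, mul_assoc, ghost_mul_vertex_of_ne _ hfv, mul_zero, mul_zero]
  rcases Set.eq_empty_or_nonempty {f : E.Edge | E.source f = v} with hemp | hne
  · rw [add_mul, hdv fun f hf => absurd hf (Set.eq_empty_iff_forall_notMem.1 hemp f), add_zero]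
    exact mul_vertex_mem_monomialSpan hz v
  -- From here `v` emits an edge, and `x v = 0` contradicts the hypothesis. For a finite emitter
  -- this is relation (e).
  refine absurd ?_ hv
  by_cases hfin : {f : E.Edge | E.source f = v}.Finite
  · rw [← sum_edge_mul_ghost v hfin hne, Finset.mul_sum]
    refine Finset.sum_eq_zero fun f _ => ?_
    rw [← mul_assoc, h, zero_mul]
  -- At an infinite emitter some edge `f` escapes the finite support of `d`. Then `d f = 0`, so `z f
  -- = 0` and `z v = 0` since `z` is real; hence `d` also kills every edge at `v`.
  · obtain ⟨f, hf, hfd⟩ := Set.Infinite.exists_notMem_finite hfin hd.1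
    have hfd : d * (edge R E f * ghost R E f) = 0 := by simpa using hfd
    have hdf : d * edge R E f = 0 := by
      rw [← edge_mul_range, ← ghost_mul_edge_self, ← mul_assoc (edge R E f), ← mul_assoc, hfd,
        zero_mul]
    have hzf : z * edge R E f = 0 := by
      have := h f
      rwa [add_mul, hdf, add_zero] at this
    have hzv : z * vertex E (1 : R) v = 0 := by
      by_cases hz0 : z = 0
      · rw [hz0, zero_mul]
      obtain ⟨k, -, hk⟩ := exists_mem_realSpan hz hz0
      obtain rfl : E.source f = v := hf
      exact mul_source_eq_zero_of_mul_edge_eq_zero hk hzf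
    rw [add_mul, hzv, zero_add]
    refine hdv fun g hg => ?_
    have := h g
    rwa [add_mul, ← source_mul_edge g, ← mul_assoc z, hg, hzv, zero_mul, zero_add, ← hg,
      source_mul_edge] at this

/-- Induction on the bound for ghost edges: an edge `f` with `x f ≠ 0` lowers it, and if there is
none, some nonzero `x v` is already real. -/
theorem exists_mul_mem_monomialSpan_zero {n : ℤ} {N : ℕ} {x : LeavittPathAlgebra R E}
    (hx : x ∈ monomialSpan R E n N) (h0 : x ≠ 0) : ∃ (m : ℤ), ∃ y ∈ degreeLE R E m,
      x * y ≠ 0 ∧ x * y ∈ monomialSpan R E (n + m) 0 := by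
  induction N generalizing n x with
  | zero =>
    obtain ⟨v, hv⟩ := exists_mul_vertex_ne_zero h0
    exact ⟨0, _, vertex_mem_degreeLE 1 v, hv, by
      simpa using mul_vertex_mem_monomialSpan hx v⟩
  | succ N ih =>
    by_cases h : ∀ f, x * edge R E f = 0
    · obtain ⟨v, hv⟩ := exists_mul_vertex_ne_zero h0
      exact ⟨0, _, vertex_mem_degreeLE 1 v, hv, by
        simpa using exists_mul_vertex_mem_of_mul_edge_eq_zero hx h v hv⟩
    · push Not at h
      obtain ⟨f, hf⟩ := h
      obtain ⟨m, y, hy, hxy, hxy'⟩ := ih (mul_edge_mem_monomialSpan hx f) hf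
      rw [mul_assoc] at hxy hxy'
      refine ⟨1 + m, _, mul_mem_degreeLE (edge_mem_degreeLE f) hy, hxy, ?_⟩
      rwa [← add_assoc]

theorem exists_mem_monomialSpan {n : ℤ} {x : LeavittPathAlgebra R E} (hx : x ∈ component R E n) :
    ∃ N, x ∈ monomialSpan R E n N := by
  have mono : ∀ {M N : ℕ}, M ≤ N → monomialSpan R E n M ≤ monomialSpan R E n N := by
    intro M N hMN
    refine AddSubgroup.closure_mono ?_
    rintro x ⟨k, j, h, hj, hn⟩
    exact ⟨k, j, h, hj.trans hMN, hn⟩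
  induction hx using AddSubgroup.closure_induction with
  | mem x hx =>
    obtain ⟨k, j, h, hn⟩ := hx
    exact ⟨j, AddSubgroup.subset_closure ⟨k, j, h, le_rfl, hn⟩⟩
  | zero => exact ⟨0, zero_mem _⟩
  | add x y _ _ hx hy =>
    obtain ⟨M, hM⟩ := hx
    obtain ⟨N, hN⟩ := hy
    exact ⟨max M N, add_mem (mono (le_max_left _ _) hM) (mono (le_max_right _ _) hN)⟩
  | neg x _ hx =>
    obtain ⟨M, hM⟩ := hx
    exact ⟨M, neg_mem hM⟩

/-- The graded reduction theorem: a nonzero homogeneous element can be multiplied to a nonzero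
multiple of a vertex. -/
theorem exists_mul_mul_eq_vertex {n : ℤ} {x : LeavittPathAlgebra R E} (hx : x ∈ component R E n)
    (h0 : x ≠ 0) : ∃ p q : ℤ, p + n + q = 0 ∧ ∃ y ∈ degreeLE R E p, ∃ z ∈ degreeLE R E q,
      ∃ (a : R) (v : E.Vertex), a ≠ 0 ∧ y * x * z = vertex E a v := by
  obtain ⟨N, hN⟩ := exists_mem_monomialSpan hx
  obtain ⟨m, z, hz, hxz, hxz'⟩ := exists_mul_mem_monomialSpan_zero hN h0
  obtain ⟨k, hk, hk'⟩ := exists_mem_realSpan hxz' hxz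
  obtain ⟨y, hy, a, v, ha, h⟩ := exists_left_mul_eq_vertex hk' hxz
  refine ⟨-k, m, by lia, y, hy, z * vertex E 1 v, ?_, a, v, ha, ?_⟩
  · simpa using mul_mem_degreeLE hz (vertex_mem_degreeLE 1 v)
  · rw [← h]; simp only [mul_assoc]

/-! ### Leading components -/

theorem component_le_degreeLE (n : ℤ) : component R E n ≤ degreeLE R E n := by
  refine AddSubgroup.closure_le _ |>.2 ?_
  rintro x ⟨k, j, h, rfl⟩
  exact h.mem_degreeLE

theorem exists_sum_component (x : LeavittPathAlgebra R E) :
    ∃ h : ℤ →₀ LeavittPathAlgebra R E, (∀ n, h n ∈ component R E n) ∧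
      (h.sum fun _ y => y) = x := by
  have hx : x ∈ AddSubgroup.closure {x : LeavittPathAlgebra R E | ∃ k j, IsMonomial k j x} := by
    rw [closure_isMonomial]; trivial
  induction hx using AddSubgroup.closure_induction with
  | mem x hx =>
    obtain ⟨k, j, h⟩ := hx
    refine ⟨Finsupp.single ((k : ℤ) - j) x, fun n => ?_, by simp⟩
    by_cases hn : (k : ℤ) - j = n
    · rw [← hn, Finsupp.single_eq_same]
      exact AddSubgroup.subset_closure ⟨k, j, h, rfl⟩
    · rw [Finsupp.single_eq_of_ne' hn]
      exact zero_mem _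
  | zero => exact ⟨0, fun n => zero_mem _, Finsupp.sum_zero_index⟩
  | add x y _ _ hx hy =>
    obtain ⟨h, hh, rfl⟩ := hx
    obtain ⟨h', hh', rfl⟩ := hy
    exact ⟨h + h', fun n => add_mem (hh n) (hh' n),
      Finsupp.sum_add_index' (fun _ => rfl) fun _ _ _ => rfl⟩
  | neg x _ hx =>
    obtain ⟨h, hh, rfl⟩ := hx
    refine ⟨-h, fun n => neg_mem (hh n), ?_⟩
    rw [Finsupp.sum_neg_index (fun _ => rfl), Finsupp.sum, Finsupp.sum, Finset.sum_neg_distrib]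

/-- The decomposition need not be unique: the top nonzero term of any one works, the other terms
lying in lower steps of the filtration. -/
theorem exists_leading_component {x : LeavittPathAlgebra R E} (hx : x ≠ 0) :
    ∃ n, ∃ y ∈ component R E n, y ≠ 0 ∧ x - y ∈ degreeLE R E (n - 1) := by
  obtain ⟨h, hh, rfl⟩ := exists_sum_component x
  have hne : h.support.Nonempty := by
    rw [Finset.nonempty_iff_ne_empty]
    intro h0
    exact hx (by rw [Finsupp.sum, h0, Finset.sum_empty])
  have hmem := h.support.max'_mem hne
  refine ⟨h.support.max' hne, _, hh _, Finsupp.mem_support_iff.1 hmem, ?_⟩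
  rw [Finsupp.sum, ← Finset.add_sum_erase _ _ hmem, add_sub_cancel_left]
  refine sum_mem fun i hi => degreeLE_mono ?_ (component_le_degreeLE i (hh i))
  have := Finset.lt_max'_of_mem_erase_max' _ hne hi
  lia

end LeavittPathAlgebra

end

/-! ### Elementwise primeness -/

/-- In a prime ring, `x S y = 0` forces `x = 0` or `y = 0`, provided that `y ∈ S y`. -/
theorem IsPrimeRing.eq_zero_or_eq_zero {S : Type*} [NonUnitalRing S] (hS : IsPrimeRing S)
    {x y e : S} (he : e * y = y) (h : ∀ t, x * t * y = 0) : x = 0 ∨ y = 0 := by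
  let A : TwoSidedIdeal S := TwoSidedIdeal.mk' {a | ∀ t, a * t * y = 0} (by simp)
    (fun {a b} ha hb t => by rw [add_mul, add_mul, ha, hb, add_zero])
    (fun {a} ha t => by rw [neg_mul, neg_mul, ha, neg_zero])
    (fun {s a} ha t => by rw [mul_assoc s, mul_assoc, ha, mul_zero])
    (fun {a s} ha t => by rw [mul_assoc a, ha])
  have hA : ∀ a, a ∈ A ↔ ∀ t, a * t * y = 0 := fun a => TwoSidedIdeal.mem_mk' ..
  -- `B` is the right annihilator of `A`, so `A B = 0`; it contains `y` because `a y = a e y = 0`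
  -- for `a ∈ A`.
  let B : TwoSidedIdeal S := TwoSidedIdeal.mk' {b | ∀ a ∈ A, a * b = 0} (by simp)
    (fun {b c} hb hc a ha => by rw [mul_add, hb a ha, hc a ha, add_zero])
    (fun {b} hb a ha => by rw [mul_neg, hb a ha, neg_zero])
    (fun {s b} hb a ha => by rw [← mul_assoc]; exact hb _ (A.mul_mem_right a s ha))
    (fun {b s} hb a ha => by rw [← mul_assoc, hb a ha, zero_mul])
  have hB : ∀ b, b ∈ B ↔ ∀ a ∈ A, a * b = 0 := fun b => TwoSidedIdeal.mem_mk' ..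
  rcases hS.2 A B fun a ha b hb => (TwoSidedIdeal.mem_bot S).2 ((hB b).1 hb a ha) with hb | hb
  · exact .inl ((TwoSidedIdeal.mem_bot S).1 (hb ((hA x).2 h)))
  · refine .inr ((TwoSidedIdeal.mem_bot S).1 (hb ((hB y).2 fun a ha => ?_)))
    rw [← he, ← mul_assoc]
    exact (hA a).1 ha e

theorem exists_ne_zero_of_bot_ne_top {S : Type*} [NonUnitalRing S]
    (h : (⊥ : TwoSidedIdeal S) ≠ ⊤) : ∃ x : S, x ≠ 0 := by
  by_contra! h0
  exact h (eq_top_iff.2 fun x _ => (TwoSidedIdeal.mem_bot S).2 (h0 x))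

theorem bot_ne_top_of_ne_zero {S : Type*} [NonUnitalRing S] {x : S} (h : x ≠ 0) :
    (⊥ : TwoSidedIdeal S) ≠ ⊤ := fun h0 =>
  h ((TwoSidedIdeal.mem_bot S).1 (h0 ▸ trivial))

/-! ### The two implications -/

noncomputable section

open DirectedGraph

namespace LeavittPathAlgebra

variable {R : Type*} [Ring R] {E : DirectedGraph}

/-- A path from `v` to `u` moves multiples of `v` to multiples of `u`. -/
theorem exists_mul_vertex_mul_eq {v u : E.Vertex} (h : E.Reaches v u) :
    ∃ m : ℤ, ∃ y ∈ degreeLE R E (-m), ∃ z ∈ degreeLE R E m,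
      ∀ a : R, y * vertex E a v * z = vertex E a u := by
  obtain ⟨p, hp⟩ := h
  induction p generalizing v with
  | nil =>
    obtain rfl : v = u := hp
    refine ⟨0, vertex E 1 v, by simpa using vertex_mem_degreeLE 1 v, vertex E 1 v,
      vertex_mem_degreeLE 1 v, fun a => ?_⟩
    rw [vertex_mul_vertex, vertex_mul_vertex, one_mul, mul_one]
  | cons f p ih =>
    obtain ⟨rfl, hp⟩ := hp
    obtain ⟨m, y, hy, z, hz, h⟩ := ih hp
    refine ⟨m + 1, y * ghost R E f, ?_, edge R E f * z, ?_, fun a => ?_⟩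
    · convert mul_mem_degreeLE hy (ghost_mem_degreeLE f) using 2
      ring
    · convert mul_mem_degreeLE (edge_mem_degreeLE f) hz using 2
      ring
    · calc y * ghost R E f * vertex E a (E.source f) * (edge R E f * z)
          = y * (ghost R E f * (vertex E a (E.source f) * edge R E f)) * z := by
            simp only [mul_assoc]
        _ = y * vertex E a (E.range f) * z := by
            rw [vertex_mul_edge, ← mul_assoc (ghost R E f), ghost_mul_edge_self,
              vertex_mul_vertex, one_mul]
        _ = vertex E a u := h a

/-- A nonzero element can be multiplied to an element whose leading term is a nonzero multiple of a
vertex, which may be replaced by any vertex that it reaches. -/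
theorem exists_mul_mul_sub_vertex_mem {x : LeavittPathAlgebra R E} (hx : x ≠ 0) :
    ∃ (a : R) (v : E.Vertex), a ≠ 0 ∧ ∀ u, E.Reaches v u →
      ∃ y z, y * x * z - vertex E a u ∈ degreeLE R E (-1) := by
  obtain ⟨n, x', hx', hx0, hsub⟩ := exists_leading_component hx
  obtain ⟨p, q, hpq, y, hy, z, hz, a, v, ha, h⟩ := exists_mul_mul_eq_vertex hx' hx0
  refine ⟨a, v, ha, fun u hu => ?_⟩
  obtain ⟨m, y', hy', z', hz', h'⟩ := exists_mul_vertex_mul_eq (R := R) hu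
  refine ⟨y' * y, z * z', ?_⟩
  have key : y' * y * x * (z * z') - vertex E a u = y' * y * (x - x') * (z * z') := by
    have : vertex E a u = y' * y * x' * (z * z') := by
      rw [← h' a, ← h]; simp only [mul_assoc]
    rw [this, mul_sub, sub_mul]
  rw [key]
  -- The degrees add up to `(-m + p) + (n - 1) + (q + m) = -1`, because `p + n + q = 0`.
  exact degreeLE_mono (by lia) (mul_mem_degreeLE (mul_mem_degreeLE (mul_mem_degreeLE hy' hy) hsub)
    (mul_mem_degreeLE hz hz'))

theorem isPrimeRing_of_mt3 [Nonempty E.Vertex] (hR : IsPrimeRing R) (hE : E.MT3) :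
    IsPrimeRing (LeavittPathAlgebra R E) := by
  refine ⟨?_, fun A B hAB => ?_⟩
  · obtain ⟨a, ha⟩ := exists_ne_zero_of_bot_ne_top hR.1
    exact bot_ne_top_of_ne_zero
      fun h => ha (eq_zero_of_vertex_eq_zero (v := Classical.arbitrary E.Vertex) h)
  by_contra! hne
  obtain ⟨x, hxA, hx⟩ := Set.not_subset.1 fun h => hne.1 fun _ hx => h hx
  obtain ⟨y, hyB, hy⟩ := Set.not_subset.1 fun h => hne.2 fun _ hx => h hx
  replace hx : x ≠ 0 := fun h => hx ((TwoSidedIdeal.mem_bot _).2 h)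
  replace hy : y ≠ 0 := fun h => hy ((TwoSidedIdeal.mem_bot _).2 h)
  obtain ⟨a, v, ha, hv⟩ := exists_mul_mul_sub_vertex_mem hx
  obtain ⟨b, w, hb, hw⟩ := exists_mul_mul_sub_vertex_mem hy
  obtain ⟨u, hvu, hwu⟩ := hE v w
  obtain ⟨c, d, hcd⟩ := hv u hvu
  obtain ⟨c', d', hcd'⟩ := hw u hwu
  set X := c * x * d
  set Y := c' * y * d'
  have hX : X ∈ A := A.mul_mem_right _ _ (A.mul_mem_left _ _ hxA)
  have hY : Y ∈ B := B.mul_mem_right _ _ (B.mul_mem_left _ _ hyB)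
  have hY0 : Y ∈ degreeLE R E 0 := by
    have := add_mem (degreeLE_mono (by lia) hcd') (vertex_mem_degreeLE b u)
    rwa [sub_add_cancel] at this
  have key : ∀ r, a * r * b = 0 := by
    intro r
    refine eq_zero_of_vertex_mem_degreeLE (v := u) ?_
    have h0 : X * vertex E r u * Y = 0 :=
      (TwoSidedIdeal.mem_bot _).1 (hAB _ (A.mul_mem_right _ _ hX) _ hY)
    -- Telescoping `X (r u) Y = 0` leaves two error terms, each with a factor of degree at most `-1`
    -- and the others of degree at most `0`.
    have hsum : vertex E (a * r * b) u = -((X - vertex E a u) * vertex E r u * Y +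
        vertex E a u * vertex E r u * (Y - vertex E b u)) := by
      rw [← vertex_mul_vertex, ← vertex_mul_vertex, sub_mul, sub_mul, mul_sub, h0]
      abel
    rw [hsum]
    have hr := vertex_mem_degreeLE r u
    exact neg_mem (add_mem (by simpa using mul_mem_degreeLE (mul_mem_degreeLE hcd hr) hY0)
      (by simpa using mul_mem_degreeLE (mul_mem_degreeLE (vertex_mem_degreeLE a u) hr) hcd'))
  rcases hR.eq_zero_or_eq_zero (one_mul b) key with h | h
  · exact ha h
  · exact hb h

/-- If `u` and `v` had no common descendant, `u L v` would vanish on monomials, hence everywhere,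
although `u` and `v` are nonzero. -/
theorem mt3_of_isPrimeRing (h : IsPrimeRing (LeavittPathAlgebra R E)) (hR : ∃ a : R, a ≠ 0) :
    E.MT3 := by
  intro u v
  by_contra! hw
  have h1 : (1 : R) ≠ 0 := by
    obtain ⟨a, ha⟩ := hR
    exact fun h1 => ha (by rw [← one_mul a, h1, zero_mul])
  have key : ∀ t, vertex E (1 : R) u * t * vertex E (1 : R) v = 0 := by
    intro t
    have ht : t ∈ AddSubgroup.closure {x : LeavittPathAlgebra R E | ∃ k j, IsMonomial k j x} := by
      rw [closure_isMonomial]; trivial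
    let T : LeavittPathAlgebra R E →+ LeavittPathAlgebra R E :=
      (AddMonoidHom.mulRight (vertex E (1 : R) v)).comp
        (AddMonoidHom.mulLeft (vertex E (1 : R) u))
    refine AddSubgroup.closure_le T.ker |>.2 ?_ ht
    rintro x ⟨k, j, hx⟩
    change vertex E (1 : R) u * x * vertex E (1 : R) v = 0
    obtain ⟨w, hxw⟩ := hx.exists_reaches
    by_cases hu : E.Reaches u w
    · rw [mul_assoc, (hxw v).2 (hw w hu), mul_zero]
    · rw [(hxw u).1 hu, zero_mul]
  rcases h.eq_zero_or_eq_zero ((vertex_mul_vertex 1 1 v).trans (by rw [one_mul])) key with h | h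
  · exact h1 (eq_zero_of_vertex_eq_zero h)
  · exact h1 (eq_zero_of_vertex_eq_zero h)

/-- The additive span of the words with coefficients in an ideal `I` of the coefficient ring. -/
def coeffSpan (E : DirectedGraph) (I : TwoSidedIdeal R) : AddSubgroup (LeavittPathAlgebra R E) :=
  AddSubgroup.closure {x | ∃ a ∈ I, ∃ w, x = mk R E (MonoidAlgebra.single w a)}

theorem mul_mem_coeffSpan (I : TwoSidedIdeal R) {x y : LeavittPathAlgebra R E}
    (hy : y ∈ coeffSpan E I) : x * y ∈ coeffSpan E I ∧ y * x ∈ coeffSpan E I := by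
  obtain ⟨x, rfl⟩ := mk_surjective R E x
  induction x using MonoidAlgebra.induction_linear with
  | zero => rw [map_zero, zero_mul, mul_zero]; exact ⟨zero_mem _, zero_mem _⟩
  | add x x' hx hx' =>
    rw [map_add, add_mul, mul_add]
    exact ⟨add_mem hx.1 hx'.1, add_mem hx.2 hx'.2⟩
  | single w b =>
    constructor
    · refine AddSubgroup.closure_le ((coeffSpan E I).comap (AddMonoidHom.mulLeft _)) |>.2 ?_ hy
      rintro _ ⟨a, ha, w', rfl⟩
      change _ * _ ∈ coeffSpan E I
      rw [← map_mul, MonoidAlgebra.single_mul_single]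
      exact AddSubgroup.subset_closure ⟨_, I.mul_mem_left _ _ ha, _, rfl⟩
    · refine AddSubgroup.closure_le ((coeffSpan E I).comap (AddMonoidHom.mulRight _)) |>.2 ?_ hy
      rintro _ ⟨a, ha, w', rfl⟩
      change _ * _ ∈ coeffSpan E I
      rw [← map_mul, MonoidAlgebra.single_mul_single]
      exact AddSubgroup.subset_closure ⟨_, I.mul_mem_right _ _ ha, _, rfl⟩

/-- The ideal of the Leavitt path algebra generated by an ideal of coefficients. -/
def coeffIdeal (E : DirectedGraph) (I : TwoSidedIdeal R) :
    TwoSidedIdeal (LeavittPathAlgebra R E) :=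
  TwoSidedIdeal.mk' (coeffSpan E I) (zero_mem _) add_mem neg_mem
    (fun h => (mul_mem_coeffSpan I h).1) (fun h => (mul_mem_coeffSpan I h).2)

theorem mem_coeffIdeal {I : TwoSidedIdeal R} {x : LeavittPathAlgebra R E} :
    x ∈ coeffIdeal E I ↔ x ∈ coeffSpan E I :=
  TwoSidedIdeal.mem_mk' ..

theorem le_bot_of_coeffIdeal_le_bot [Nonempty E.Vertex] {I : TwoSidedIdeal R}
    (h : coeffIdeal E I ≤ ⊥) : I ≤ ⊥ := by
  intro a ha
  have : vertex E a (Classical.arbitrary E.Vertex) ∈ coeffIdeal E I :=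
    mem_coeffIdeal.2 (AddSubgroup.subset_closure ⟨a, ha, _, rfl⟩)
  exact (TwoSidedIdeal.mem_bot R).2
    (eq_zero_of_vertex_eq_zero ((TwoSidedIdeal.mem_bot _).1 (h this)))

/-- A product of words with coefficients `b ∈ I` and `c ∈ J` has coefficient `b c = 0`, so the
coefficient ideals multiply to zero; a zero coefficient ideal forces a zero ideal of `R`, as `a v =
0` only for `a = 0`. -/
theorem isPrimeRing_coeff [Nonempty E.Vertex] (h : IsPrimeRing (LeavittPathAlgebra R E))
    (hR : ∃ a : R, a ≠ 0) : IsPrimeRing R := by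
  obtain ⟨a, ha⟩ := hR
  refine ⟨bot_ne_top_of_ne_zero ha, fun I J hIJ => ?_⟩
  refine (h.2 (coeffIdeal E I) (coeffIdeal E J) fun x hx y hy => ?_).imp
    le_bot_of_coeffIdeal_le_bot le_bot_of_coeffIdeal_le_bot
  rw [mem_coeffIdeal] at hx hy
  refine (TwoSidedIdeal.mem_bot _).2 ?_
  refine AddSubgroup.closure_le (AddMonoidHom.mulRight y).ker |>.2 ?_ hx
  rintro _ ⟨b, hb, w, rfl⟩
  refine AddSubgroup.closure_le (AddMonoidHom.mulLeft (mk R E (MonoidAlgebra.single w b))).ker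
    |>.2 ?_ hy
  rintro _ ⟨c, hc, w', rfl⟩
  change mk R E _ * mk R E _ = 0
  rw [← map_mul, MonoidAlgebra.single_mul_single, (TwoSidedIdeal.mem_bot R).1 (hIJ b hb c hc),
    MonoidAlgebra.single_zero, map_zero]

theorem exists_coeff_ne_zero (h : ∃ x : LeavittPathAlgebra R E, x ≠ 0) : ∃ a : R, a ≠ 0 := by
  by_contra! hR
  obtain ⟨x, hx⟩ := h
  obtain ⟨x, rfl⟩ := mk_surjective R E x
  refine hx ?_
  rw [← one_smul R x, hR 1, zero_smul, map_zero]

end LeavittPathAlgebra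

end

theorem theorem1p6 (R : Type*) [Ring R] (E : DirectedGraph) [Nonempty E.Vertex] :
    IsPrimeRing (LeavittPathAlgebra R E) ↔ IsPrimeRing R ∧ E.MT3 := by
  refine ⟨fun h => ?_, fun h => LeavittPathAlgebra.isPrimeRing_of_mt3 h.1 h.2⟩
  have hR := LeavittPathAlgebra.exists_coeff_ne_zero (exists_ne_zero_of_bot_ne_top h.1)
  exact ⟨LeavittPathAlgebra.isPrimeRing_coeff h hR, LeavittPathAlgebra.mt3_of_isPrimeRing h hR⟩
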